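/- Let $L=2m+1\ge 3$ be an odd prime and let $N\ge 2$. Let $\mathcal H=\mathcal H_P\otimes\mathcal H_C$, where $\mathcal H_P$ is the complex Hilbert space with orthonormal basis $|k\rangle$, $k\in\mathbf Z/N\mathbf Z$ (the vertices of the cycle graph $C_N$), and $\mathcal H_C$ is the complex Hilbert space with ordered orthonormal basis $(|\!\leftarrow m\rangle,\dots,|\!\leftarrow 1\rangle,|\cdot\rangle,|1\rightarrow\rangle,\dots,|m\rightarrow\rangle)$. Let $S$ be the shift operator on $\mathcal H$ given by $$S(|k\rangle\otimes|\!\leftarrow j\rangle)=|k-j\rangle\otimes|\!\leftarrow j\rangle,\quad S(|k\rangle\otimes|\cdot\rangle)=|k\rangle\otimes|\cdot\rangle,\quad S(|k\rangle\otimes|j\rightarrow\rangle)=|k+j\rangle\otimes|j\rightarrow\rangle\qquad(1\le j\le m),$$ and let $A^{F,L}$ be the operator on $\mathcal H_C$ whose matrix in the above ordered basis is $\frac1L$ times the $L\times L$ matrix with entries $-(2m-1)$ on the anti-diagonal and $2$ elsewhere. The $L$-state F-type Grover walk on $C_N$ has the time-evolution operator $U^{F,L}_N=S\,\bigl(\sum_{k}|k\rangle\langle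 k|\otimes A^{F,L}\bigr)$, and its period is $$T^{F,L}_N=\inf\{\,n\ge 1 : (U^{F,L}_N)^n=1\,\}\in\{1,2,\dots\}\cup\{\infty\},$$ with $\inf\emptyset=\infty$. Then $$T^{F,L}_N=\begin{cases}4,&N=L,\\ \infty,&N\ne L.\end{cases}$$ -/

import Mathlib

open scoped Kronecker

noncomputable section

namespace CycleWalk

/-- The half-width `m = (L - 1) / 2` of an odd number `L = 2 * m + 1` of chirality states. -/
def halfWidth (L : ℕ) : ℕ := (L - 1) / 2

/-- The chirality states are indexed by `Fin L`, in the order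
`(← m, …, ← 1, ·, 1 →, …, m →)`. The state with index `c` moves the walker by `c - m`:
`← j` (index `m - j`) by `-j`, `·` (index `m`) by `0`, and `j →` (index `m + j`) by `j`. -/
def displacement (L : ℕ) (c : Fin L) : ℤ := (c : ℤ) - (halfWidth L : ℤ)

/-- Index set of the orthonormal basis `|k⟩ ⊗ |c⟩` of the state space of an `L`-state quantum
walk on the cycle with `N` vertices; the vertices are the residues modulo `N`. Operators on the
state space are given by their complex matrices in this basis. -/
abbrev Site (L N : ℕ) : Type := ZMod N × Fin L

/-- The shift operator `S (|k⟩ ⊗ |c⟩) = |k + displacement c⟩ ⊗ |c⟩`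
(columns are the images of the basis vectors). -/
def shift (L N : ℕ) : Matrix (Site L N) (Site L N) ℂ :=
  Matrix.of fun p q => if p = (q.1 + ((displacement L q.2 : ℤ) : ZMod N), q.2) then 1 else 0

/-- The coin operator `C = ∑ k, |k⟩⟨k| ⊗ A` with local coin operator `A`. -/
def coin (L N : ℕ) [NeZero N] (A : Matrix (Fin L) (Fin L) ℂ) :
    Matrix (Site L N) (Site L N) ℂ :=
  ∑ k : ZMod N, Matrix.single k k (1 : ℂ) ⊗ₖ A

/-- The time-evolution operator `U = S C` of the quantum walk with local coin operator `A`. -/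
def timeEvolution (L N : ℕ) [NeZero N] (A : Matrix (Fin L) (Fin L) ℂ) :
    Matrix (Site L N) (Site L N) ℂ :=
  shift L N * coin L N A

/-- The local coin operator of the F-type Grover walk: `1 / L` times the matrix with entries
`-(2 m - 1)` on the anti-diagonal and `2` elsewhere. -/
def groverCoinF (L : ℕ) : Matrix (Fin L) (Fin L) ℂ :=
  Matrix.of fun i j =>
    (1 / (L : ℂ)) * (if j = Fin.rev i then -(2 * (halfWidth L : ℂ) - 1) else 2)

/-- The time-evolution operator of the F-type Grover walk with `L` states on the cycle with
`N` vertices. -/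
def groverWalkF (L N : ℕ) [NeZero N] : Matrix (Site L N) (Site L N) ℂ :=
  timeEvolution L N (groverCoinF L)

/-- The period `inf {n ≥ 1 | U ^ n = 1}` of the quantum walk with time-evolution operator `U`,
in `ℕ ∪ {∞}`; the infimum of the empty set is `∞`. -/
def period {ι : Type*} [Fintype ι] [DecidableEq ι] (U : Matrix ι ι ℂ) : ℕ∞ :=
  sInf {t : ℕ∞ | ∃ n : ℕ, 1 ≤ n ∧ U ^ n = 1 ∧ t = (n : ℕ∞)}

end CycleWalk

end

open Matrix

namespace CycleWalk

/-! ### Matrix entries and action of the walk -/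

section Operators

variable {L N : ℕ}

/-! For a character `ψ` of `ZMod N`, the plane wave `u` and its image `v = U u` span an invariant
subspace, since `U v = t v - u` with `t = waveTrace L ψ`. If `U ^ n = 1` and `ψ 1 ≠ 1`, the roots of
`X² - tX + 1` are roots of unity, so `t` is an algebraic integer. Up to a unit, `t` is `(2 / L)(1 +
ω + ⋯ + ω^(L-1))` with `ω ^ N = 1`. If `N ≠ L`, some such `ω ≠ 1` makes this non-integral: one of
order prime to `L`, where the sum is a unit, or one of order `L²`, where a norm computation decides.

If `N = L`, the displacements fill `ZMod L`. Then `U = F(2E - 1)` for an involution `F` and a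
projection `E` such that `E` and `FEF` commute, whence `U ^ 4 = 1`. For `ψ ≠ 1` the trace `t`
vanishes, so `u ↦ v ↦ -u ↦ -v` excludes smaller exponents. -/

lemma two_mul_halfWidth_add_one (hL : Odd L) : 2 * halfWidth L + 1 = L := by
  obtain ⟨m, rfl⟩ := hL
  simp [halfWidth]

lemma displacement_rev (hL : Odd L) (c : Fin L) :
    displacement L (Fin.rev c) = -displacement L c := by
  have h := two_mul_halfWidth_add_one hL
  have hc := c.isLt
  simp only [displacement, Fin.val_rev]
  omega

lemma shift_mulVec [NeZero N] (f : Site L N → ℂ) (p : Site L N) :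
    (shift L N *ᵥ f) p = f (p.1 - ((displacement L p.2 : ℤ) : ZMod N), p.2) := by
  simp only [mulVec, dotProduct, shift, of_apply, ite_mul, one_mul, zero_mul]
  rw [Finset.sum_eq_single (p.1 - ((displacement L p.2 : ℤ) : ZMod N), p.2)]
  · simp
  · rintro ⟨k, c⟩ - hne
    rw [if_neg]
    rintro rfl
    simp at hne
  · simp

lemma coin_mulVec [NeZero N] (A : Matrix (Fin L) (Fin L) ℂ) (f : Site L N → ℂ) (p : Site L N) :
    (coin L N A *ᵥ f) p = ∑ c, A p.2 c * f (p.1, c) := by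
  obtain ⟨k, b⟩ := p
  simp only [coin, mulVec, dotProduct, Matrix.sum_apply, kroneckerMap_apply,
    Fintype.sum_prod_type]
  rw [Finset.sum_eq_single k]
  · refine Finset.sum_congr rfl fun c _ => ?_
    rw [Finset.sum_eq_single k]
    · simp
    · intro j _ hj
      simp [hj]
    · simp
  · intro j _ hj
    refine Finset.sum_eq_zero fun c _ => ?_
    rw [Finset.sum_eq_zero, zero_mul]
    intro i _
    rw [single_apply, if_neg, zero_mul]
    rintro ⟨rfl, rfl⟩
    exact hj rfl
  · simp

/-- As `L = 2m + 1`, `-(2m - 1) / L = 2 / L - 1`: the coin is twice the mean minus the reversal. -/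
lemma groverCoinF_apply (hL : Odd L) (i j : Fin L) :
    groverCoinF L i j = 2 / L - if j = Fin.rev i then 1 else 0 := by
  have h : (2 * (halfWidth L : ℂ) + 1) = L := by exact_mod_cast two_mul_halfWidth_add_one hL
  have h0 : (L : ℂ) ≠ 0 := by exact_mod_cast hL.pos.ne'
  simp only [groverCoinF, of_apply]
  split_ifs
  · field_simp
    linear_combination -h
  · ring

lemma groverWalkF_mulVec [NeZero N] (hL : Odd L) (f : Site L N → ℂ) (p : Site L N) :
    (groverWalkF L N *ᵥ f) p =
      2 / L * ∑ c, f (p.1 - ((displacement L p.2 : ℤ) : ZMod N), c) -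
        f (p.1 - ((displacement L p.2 : ℤ) : ZMod N), Fin.rev p.2) := by
  rw [groverWalkF, timeEvolution, ← mulVec_mulVec, shift_mulVec, coin_mulVec]
  simp [groverCoinF_apply hL, sub_mul, Finset.sum_sub_distrib, Finset.mul_sum]

end Operators

/-! ### Invariant planes of plane waves and integrality of the trace -/

section PlaneWaves

variable {L N : ℕ}

/-- The plane wave with momentum `ψ`, constant in the chirality. -/
def planeWave (L : ℕ) (ψ : AddChar (ZMod N) ℂ) : Site L N → ℂ := fun p => ψ p.1

/-- The image of `planeWave L ψ` under the F-type Grover walk. -/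
def shiftedPlaneWave (L : ℕ) (ψ : AddChar (ZMod N) ℂ) : Site L N → ℂ :=
  fun p => ψ (p.1 - ((displacement L p.2 : ℤ) : ZMod N))

/-- Twice the mean value of `ψ` over the displacements of the walker. -/
noncomputable def waveTrace (L : ℕ) (ψ : AddChar (ZMod N) ℂ) : ℂ :=
  2 / L * ∑ c : Fin L, ψ (-((displacement L c : ℤ) : ZMod N))

lemma groverWalkF_mulVec_planeWave [NeZero N] (hL : Odd L) (ψ : AddChar (ZMod N) ℂ) :
    groverWalkF L N *ᵥ planeWave L ψ = shiftedPlaneWave L ψ := by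
  have h0 : (L : ℂ) ≠ 0 := by exact_mod_cast hL.pos.ne'
  funext p
  rw [groverWalkF_mulVec hL]
  simp only [planeWave, shiftedPlaneWave, Finset.sum_const, Finset.card_univ, Fintype.card_fin,
    nsmul_eq_mul]
  field_simp
  ring

lemma groverWalkF_mulVec_shiftedPlaneWave [NeZero N] (hL : Odd L) (ψ : AddChar (ZMod N) ℂ) :
    groverWalkF L N *ᵥ shiftedPlaneWave L ψ =
      waveTrace L ψ • shiftedPlaneWave L ψ - planeWave L ψ := by
  funext p
  rw [groverWalkF_mulVec hL]
  simp only [planeWave, shiftedPlaneWave, waveTrace, Pi.sub_apply, Pi.smul_apply, smul_eq_mul,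
    displacement_rev hL, Int.cast_neg, sub_neg_eq_add, sub_add_cancel]
  congr 1
  rw [mul_assoc, Finset.sum_mul]
  congr 1
  refine Finset.sum_congr rfl fun c _ => ?_
  rw [← AddChar.map_add_eq_mul]
  congr 1
  ring

lemma eq_zero_of_smul_shiftedPlaneWave_eq (hL : Odd L) (hL3 : 3 ≤ L) {ψ : AddChar (ZMod N) ℂ}
    (hψ : ψ 1 ≠ 1) {a b : ℂ} (h : a • shiftedPlaneWave L ψ = b • planeWave L ψ) :
    a = 0 ∧ b = 0 := by
  have hm := two_mul_halfWidth_add_one hL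
  -- At these two sites the shifted wave equals `1`, while the plane wave takes the values `1` and
  -- `ψ 1`.
  have h₀ := congrFun h (0, ⟨halfWidth L, by omega⟩)
  have h₁ := congrFun h (1, ⟨halfWidth L + 1, by omega⟩)
  simp only [shiftedPlaneWave, planeWave, displacement, Pi.smul_apply, smul_eq_mul, sub_self,
    Nat.cast_add, Nat.cast_one, add_sub_cancel_left, Int.cast_one, Int.cast_zero,
    AddChar.map_zero_eq_one, mul_one] at h₀ h₁
  have hb : b = 0 := by
    have : b * (ψ 1 - 1) = 0 := by linear_combination h₀ - h₁
    exact (mul_eq_zero.mp this).resolve_right (sub_ne_zero.mpr hψ)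
  exact ⟨h₀.trans hb, hb⟩

/-- If the walk is periodic, then its eigenvalues on the span of a plane wave are roots of unity,
so their sum is an algebraic integer. -/
lemma isIntegral_waveTrace_of_pow_eq_one [NeZero N] (hL : Odd L) (hL3 : 3 ≤ L)
    {ψ : AddChar (ZMod N) ℂ} (hψ : ψ 1 ≠ 1) {n : ℕ} (hn : 1 ≤ n)
    (hU : groverWalkF L N ^ n = 1) : IsIntegral ℤ (waveTrace L ψ) := by
  set t := waveTrace L ψ with ht
  obtain ⟨r, hr⟩ := IsAlgClosed.exists_pow_nat_eq (t ^ 2 - 4) (n := 2) (by norm_num)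
  -- A root of `X² - tX + 1`; the other root is `μ⁻¹`.
  set μ : ℂ := (t + r) / 2 with hμ
  have hquad : μ * μ = t * μ - 1 := by
    rw [hμ]
    linear_combination hr / 4
  have hμ0 : μ ≠ 0 := by
    intro h
    simp [h] at hquad
  set w := μ • shiftedPlaneWave L ψ - planeWave L ψ with hw
  have hw0 : w ≠ 0 := by
    intro h
    have := eq_zero_of_smul_shiftedPlaneWave_eq hL hL3 hψ (a := μ) (b := 1)
      (by rw [one_smul]; exact sub_eq_zero.mp h)
    exact one_ne_zero this.2
  have heig : groverWalkF L N *ᵥ w = μ • w := by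
    rw [hw, mulVec_sub, mulVec_smul, groverWalkF_mulVec_planeWave hL,
      groverWalkF_mulVec_shiftedPlaneWave hL, ← ht]
    funext p
    simp only [Pi.sub_apply, Pi.smul_apply, smul_eq_mul]
    linear_combination -(shiftedPlaneWave L ψ p) * hquad
  have hpow : ∀ k : ℕ, (groverWalkF L N ^ k) *ᵥ w = μ ^ k • w := by
    intro k
    induction k with
    | zero => simp
    | succ k ih => rw [pow_succ, ← mulVec_mulVec, heig, mulVec_smul, ih, smul_smul, pow_succ']
  have hroot : μ ^ n = 1 := by
    have h := hpow n
    rw [hU, one_mulVec] at h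
    have h' : (μ ^ n - 1) • w = 0 := by rw [sub_smul, one_smul, ← h, sub_self]
    exact sub_eq_zero.mp ((smul_eq_zero.mp h').resolve_right hw0)
  have hsum : t = μ + μ⁻¹ := by
    field_simp
    linear_combination -hquad
  rw [hsum]
  refine IsIntegral.add (IsIntegral.of_pow hn ?_) (IsIntegral.of_pow hn ?_)
  · rw [hroot]; exact isIntegral_one
  · rw [inv_pow, hroot, inv_one]; exact isIntegral_one

/-- Displacements start at `-m`; pulling out the unit `ω ^ m` leaves a geometric sum. -/
lemma waveTrace_zmodChar [NeZero N] {ω : ℂ} (hω : ω ^ N = 1) :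
    ω ^ halfWidth L * (2 / L * ∑ j ∈ Finset.range L, (ω⁻¹) ^ j) =
      waveTrace L (AddChar.zmodChar N hω) := by
  have hψ (n : ℕ) : AddChar.zmodChar N hω (n : ZMod N) = ω ^ n := AddChar.zmodChar_apply' hω n
  rw [waveTrace, mul_left_comm, Finset.sum_range, Finset.mul_sum]
  congr 1
  refine Finset.sum_congr rfl fun c _ => ?_
  have : (-((displacement L c : ℤ) : ZMod N)) = (halfWidth L : ZMod N) + -((c : ℕ) : ZMod N) := by
    simp [displacement, sub_eq_add_neg]
  rw [this, AddChar.map_add_eq_mul, AddChar.map_neg_eq_inv, hψ, hψ, inv_pow]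

lemma isIntegral_geom_sum_of_pow_eq_one [NeZero N] (hL : Odd L) (hL3 : 3 ≤ L) {ω : ℂ}
    (hω : ω ^ N = 1) (hω1 : ω ≠ 1) {n : ℕ} (hn : 1 ≤ n) (hU : groverWalkF L N ^ n = 1) :
    IsIntegral ℤ (2 / L * ∑ j ∈ Finset.range L, ω ^ j : ℂ) := by
  have hω' : ω⁻¹ ^ N = 1 := by rw [inv_pow, hω, inv_one]
  have hω0 : ω ≠ 0 := by
    rintro rfl
    simp [NeZero.ne N] at hω
  have hψ : AddChar.zmodChar N hω' 1 = ω⁻¹ := by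
    simpa using AddChar.zmodChar_apply' hω' 1
  have h := isIntegral_waveTrace_of_pow_eq_one hL hL3 (ψ := AddChar.zmodChar N hω')
    (by rw [hψ]; simpa using hω1) hn hU
  rw [← waveTrace_zmodChar, inv_inv] at h
  have hint : IsIntegral ℤ (ω ^ halfWidth L) :=
    (IsIntegral.of_pow (NeZero.pos N) (hω ▸ isIntegral_one)).pow _
  have := hint.mul h
  rwa [← mul_assoc, ← mul_pow, mul_inv_cancel₀ hω0, one_pow, one_mul] at this

end PlaneWaves

/-! ### Non-integrality of scaled geometric sums -/

section Arithmetic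

lemma dvd_of_isIntegral_natCast_div {K : Type*} [Field K] [CharZero K] {a b : ℕ} (hb : b ≠ 0)
    (h : IsIntegral ℤ ((a : K) / b)) : b ∣ a := by
  have h' : IsIntegral ℤ ((a : ℚ) / b) := by
    rw [← isIntegral_algebraMap_iff (B := K) (algebraMap ℚ K).injective]
    simpa using h
  obtain ⟨z, hz⟩ := IsIntegrallyClosed.isIntegral_iff.mp h'
  have hb' : (b : ℚ) ≠ 0 := by exact_mod_cast hb
  rw [eq_div_iff hb'] at hz
  have hz' : z * (b : ℤ) = a := by
    rw [eq_intCast] at hz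
    exact_mod_cast hz
  exact Int.natCast_dvd_natCast.mp ⟨z, by rw [← hz', mul_comm]⟩

variable {L : ℕ}

/-- If `ω` has order prime to `L`, then `1 + ω + ⋯ + ω ^ (L - 1)` is a unit. -/
lemma not_isIntegral_geom_sum_of_coprime (hL3 : 3 ≤ L) {M : ℕ} (hM : 2 ≤ M)
    (hLM : L.Coprime M) {ω : ℂ} (hω : IsPrimitiveRoot ω M) :
    ¬ IsIntegral ℤ (2 / L * ∑ j ∈ Finset.range L, ω ^ j : ℂ) := by
  intro h
  -- With `L * k ≡ 1` mod `M`, the inverse `(ω - 1) / (ω^L - 1)` of the sum is itself a geometric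
  -- sum in `ω^L`, hence integral; so `2 / L` would be integral.
  obtain ⟨k, -, hk⟩ := Nat.exists_mul_mod_eq_one_of_coprime hLM (by omega)
  have hωk : (ω ^ L) ^ k = ω := by
    rw [← pow_mul, ← Nat.div_add_mod (L * k) M, hk, pow_add, pow_mul, hω.pow_eq_one]
    simp
  have hω1 : ω - 1 ≠ 0 := sub_ne_zero.mpr (hω.ne_one (by omega))
  have hint : IsIntegral ℤ ω := hω.isIntegral (by omega)
  have hprod : (∑ j ∈ Finset.range L, ω ^ j) * ∑ j ∈ Finset.range k, (ω ^ L) ^ j = 1 := by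
    have h₁ := geom_sum_mul ω L
    have h₂ := geom_sum_mul (ω ^ L) k
    rw [hωk] at h₂
    apply mul_right_cancel₀ hω1
    linear_combination (∑ j ∈ Finset.range k, (ω ^ L) ^ j) * h₁ + h₂
  have h2 := h.mul (IsIntegral.sum (fun j => (ω ^ L) ^ j) (s := Finset.range k)
    fun j _ => (hint.pow L).pow j)
  rw [mul_assoc, hprod, mul_one] at h2
  have := Nat.le_of_dvd (by norm_num)
    (dvd_of_isIntegral_natCast_div (K := ℂ) (a := 2) (b := L) (by omega) (by exact_mod_cast h2))
  omega

/-- The norms of `ζ - 1` and `ζ^L - 1` are `L` and `L^L`, but that of the scalar `L` is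
`L^(L(L-1))`. An integral value would force `L` to divide a power of `2`. -/
lemma not_isIntegral_geom_sum_of_isCyclotomicExtension (hL : L.Prime) (hL3 : 3 ≤ L)
    {K : Type*} [Field K] [CharZero K] [Algebra ℚ K]
    [IsCyclotomicExtension {L ^ (1 + 1)} ℚ K] {ζ : K}
    (hζ : IsPrimitiveRoot ζ (L ^ (1 + 1))) :
    ¬ IsIntegral ℤ (2 / L * ∑ j ∈ Finset.range L, ζ ^ j : K) := by
  have : Fact L.Prime := ⟨hL⟩
  have : NeZero (L ^ (1 + 1)) := ⟨pow_ne_zero _ hL.ne_zero⟩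
  have hL0 : (L : K) ≠ 0 := by exact_mod_cast hL.ne_zero
  generalize hy : (2 / L * ∑ j ∈ Finset.range L, ζ ^ j : K) = y
  intro hyint
  have hrel : algebraMap ℚ K L * y * (ζ - 1) = algebraMap ℚ K 2 * (ζ ^ L ^ 1 - 1) := by
    rw [pow_one, ← geom_sum_mul ζ L, ← hy, map_natCast, map_ofNat]
    field_simp
  have hirr : Irreducible (Polynomial.cyclotomic (L ^ (1 + 1)) ℚ) :=
    Polynomial.cyclotomic.irreducible_rat (pow_pos hL.pos _)
  have hnorm := congrArg (Algebra.norm ℚ) hrel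
  have hdeg : Module.finrank ℚ K = L * (L - 1) := by
    rw [IsCyclotomicExtension.finrank (n := L ^ (1 + 1)) K hirr, Nat.totient_prime_pow_succ hL,
      pow_one]
  rw [map_mul, map_mul, map_mul, Algebra.norm_algebraMap, Algebra.norm_algebraMap, hdeg,
    hζ.norm_sub_one_of_prime_ne_two hirr (by omega),
    hζ.norm_pow_sub_one_of_prime_ne_two hirr (by omega) (by omega)] at hnorm
  obtain ⟨z, hz⟩ := IsIntegrallyClosed.isIntegral_iff.mp (Algebra.isIntegral_norm ℚ hyint)
  rw [← hz] at hnorm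
  have hnorm' : (L : ℤ) ^ (L * (L - 1)) * z * L = 2 ^ (L * (L - 1)) * L ^ L := by
    rw [pow_one, eq_intCast] at hnorm
    exact_mod_cast hnorm
  have hexp : L * (L - 1) = L + L * (L - 2) := by
    obtain ⟨k, rfl⟩ := Nat.exists_eq_add_of_le hL3
    simp only [show 3 + k - 1 = k + 2 by omega, show 3 + k - 2 = k + 1 by omega]
    ring
  have hdvd : (L : ℤ) ∣ 2 ^ (L * (L - 1)) := by
    have hLL : (L : ℤ) ^ L ≠ 0 := pow_ne_zero _ (by exact_mod_cast hL.ne_zero)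
    refine ⟨L ^ (L * (L - 2)) * z, mul_right_cancel₀ hLL ?_⟩
    rw [← hnorm']
    nth_rewrite 1 [hexp]
    rw [pow_add]
    ring
  have h2 := (Nat.prime_iff_prime_int.mp hL).dvd_of_dvd_pow hdvd
  have := Int.le_of_dvd (by norm_num) h2
  omega

/-- Norms need a number field; an embedding into `ℂ` transports the result, since it reflects
integrality. -/
lemma exists_isPrimitiveRoot_sq_not_isIntegral_geom_sum (hL : L.Prime) (hL3 : 3 ≤ L) :
    ∃ ω : ℂ, IsPrimitiveRoot ω (L ^ 2) ∧
      ¬ IsIntegral ℤ (2 / L * ∑ j ∈ Finset.range L, ω ^ j : ℂ) := by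
  have : NeZero (L ^ (1 + 1)) := ⟨pow_ne_zero _ hL.ne_zero⟩
  obtain ⟨K, _, _, _, _⟩ : ∃ (K : Type) (_ : Field K) (_ : CharZero K) (_ : Algebra ℚ K),
      IsCyclotomicExtension {L ^ (1 + 1)} ℚ K :=
    ⟨CyclotomicField (L ^ (1 + 1)) ℚ, inferInstance, inferInstance, _,
      CyclotomicField.isCyclotomicExtension (L ^ (1 + 1)) ℚ⟩
  have hζ := IsCyclotomicExtension.zeta_spec (L ^ (1 + 1)) ℚ K
  have : Algebra.IsIntegral ℚ K := IsCyclotomicExtension.integral {L ^ (1 + 1)} ℚ K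
  let φ : K →ₐ[ℚ] ℂ := IsAlgClosed.lift
  refine ⟨φ _, hζ.map_of_injective φ.injective, fun h =>
    not_isIntegral_geom_sum_of_isCyclotomicExtension hL hL3 hζ ?_⟩
  rw [← isIntegral_algHom_iff (φ.restrictScalars ℤ) φ.injective]
  simpa only [AlgHom.restrictScalars_apply, map_mul, map_div₀, map_ofNat, map_natCast, map_sum,
    map_pow] using h

lemma exists_not_isIntegral_geom_sum (hL : L.Prime) (hL3 : 3 ≤ L) {N : ℕ} (hN : 2 ≤ N)
    (hNL : N ≠ L) :
    ∃ ω : ℂ, ω ^ N = 1 ∧ ω ≠ 1 ∧ ¬ IsIntegral ℤ (2 / L * ∑ j ∈ Finset.range L, ω ^ j : ℂ) := by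
  by_cases h2 : L ^ 2 ∣ N
  · obtain ⟨ω, hω, hint⟩ := exists_isPrimitiveRoot_sq_not_isIntegral_geom_sum hL hL3
    exact ⟨ω, (hω.pow_eq_one_iff_dvd N).mpr h2, hω.ne_one (by nlinarith), hint⟩
  · obtain ⟨M, hMN, hM2, hLM⟩ : ∃ M, M ∣ N ∧ 2 ≤ M ∧ L.Coprime M := by
      by_cases h1 : L ∣ N
      · obtain ⟨M, rfl⟩ := h1
        -- Here `N = L * M`: `M ≠ 1` because `N ≠ L`, and `L ∤ M` because `L² ∤ N`.
        refine ⟨M, dvd_mul_left _ _, ?_, (Nat.Prime.coprime_iff_not_dvd hL).mpr fun h => h2 ?_⟩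
        · rcases M with _ | _ | M
          · simp at hN
          · simp at hNL
          · omega
        · rw [pow_two]
          exact mul_dvd_mul_left L h
      · exact ⟨N, dvd_rfl, hN, (Nat.Prime.coprime_iff_not_dvd hL).mpr h1⟩
    have hω := Complex.isPrimitiveRoot_exp M (by omega)
    exact ⟨_, (hω.pow_eq_one_iff_dvd N).mpr hMN, hω.ne_one (by omega),
      not_isIntegral_geom_sum_of_coprime hL3 hM2 hLM hω⟩

end Arithmetic

/-! ### The cycle of length `L`: period four -/

section EqualSize

variable {L : ℕ}

/-- The displacements are `L` consecutive integers, hence a complete residue system mod `L`. -/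
lemma sum_displacement [NeZero L] {M : Type*} [AddCommMonoid M] (g : ZMod L → M) (k : ZMod L) :
    ∑ c : Fin L, g (k - ((displacement L c : ℤ) : ZMod L)) = ∑ j, g j := by
  refine Fintype.sum_bijective (fun c : Fin L => k - ((displacement L c : ℤ) : ZMod L)) ?_ _ _
    fun _ => rfl
  rw [Fintype.bijective_iff_injective_and_card]
  refine ⟨fun a b hab => ?_, by simp [ZMod.card]⟩
  simp only [displacement, Int.cast_sub, Int.cast_natCast, sub_right_inj, sub_left_inj] at hab
  rw [ZMod.natCast_eq_natCast_iff', Nat.mod_eq_of_lt a.isLt, Nat.mod_eq_of_lt b.isLt] at hab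
  exact Fin.ext hab

/-- The flip-flop shift: reverse the chirality, then shift. -/
def flipShift (L : ℕ) : Module.End ℂ (Site L L → ℂ) where
  toFun f p := f (p.1 - ((displacement L p.2 : ℤ) : ZMod L), Fin.rev p.2)
  map_add' _ _ := rfl
  map_smul' _ _ := rfl

/-- Averaging over the chiralities. -/
noncomputable def chiralityMean (L : ℕ) : Module.End ℂ (Site L L → ℂ) where
  toFun f p := (L : ℂ)⁻¹ * ∑ c, f (p.1, c)
  map_add' f g := by funext p; simp [Finset.sum_add_distrib, mul_add]
  map_smul' a f := by funext p; simp [← Finset.mul_sum, mul_left_comm]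

lemma flipShift_mul_self (hL : Odd L) : flipShift L * flipShift L = 1 := by
  refine LinearMap.ext fun f => funext fun p => ?_
  simp [flipShift, displacement_rev hL]

lemma chiralityMean_mul_self (hL : Odd L) :
    chiralityMean L * chiralityMean L = chiralityMean L := by
  have h0 : (L : ℂ) ≠ 0 := by exact_mod_cast hL.pos.ne'
  refine LinearMap.ext fun f => funext fun p => ?_
  simp [chiralityMean, h0]

/-- The compression of the flip-flop shift to chirality-constant functions is the global mean, which
the shift fixes on either side. -/
lemma chiralityMean_mul_flipShift_mul_chiralityMean_apply [NeZero L] (f : Site L L → ℂ)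
    (p : Site L L) :
    (chiralityMean L * flipShift L * chiralityMean L) f p =
      (L : ℂ)⁻¹ * ∑ k, (L : ℂ)⁻¹ * ∑ c, f (k, c) := by
  simp only [chiralityMean, flipShift, Module.End.mul_apply, LinearMap.coe_mk, AddHom.coe_mk]
  rw [sum_displacement fun k => (L : ℂ)⁻¹ * ∑ c, f (k, c)]

lemma flipShift_mul_mean [NeZero L] :
    flipShift L * (chiralityMean L * flipShift L * chiralityMean L) =
      chiralityMean L * flipShift L * chiralityMean L := by
  refine LinearMap.ext fun f => funext fun p => ?_
  rw [chiralityMean_mul_flipShift_mul_chiralityMean_apply, Module.End.mul_apply]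
  exact chiralityMean_mul_flipShift_mul_chiralityMean_apply f _

lemma mean_mul_flipShift [NeZero L] :
    chiralityMean L * flipShift L * chiralityMean L * flipShift L =
      chiralityMean L * flipShift L * chiralityMean L := by
  refine LinearMap.ext fun f => funext fun p => ?_
  rw [Module.End.mul_apply, chiralityMean_mul_flipShift_mul_chiralityMean_apply,
    chiralityMean_mul_flipShift_mul_chiralityMean_apply]
  simp only [← Finset.mul_sum, flipShift, LinearMap.coe_mk, AddHom.coe_mk]
  congr 2
  rw [Finset.sum_comm, Finset.sum_comm (f := fun k c => f (k, c))]
  rw [← Equiv.sum_comp Fin.revPerm (fun c => ∑ k, f (k, c))]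
  refine Finset.sum_congr rfl fun c _ => ?_
  exact Equiv.sum_comp (Equiv.subRight ((displacement L c : ℤ) : ZMod L))
    fun k => f (k, Fin.rev c)

lemma toLin'_groverWalkF_self [NeZero L] (hL : Odd L) :
    Matrix.toLin' (groverWalkF L L) =
      flipShift L * (chiralityMean L + chiralityMean L - 1) := by
  refine LinearMap.ext fun f => funext fun p => ?_
  rw [Matrix.toLin'_apply, groverWalkF_mulVec hL]
  simp [flipShift, chiralityMean]
  ring

/-- In a ring, let `t` be an involution and `e` an idempotent such that `t` fixes `e * t * e` on
both sides. Then `t * (2 * e - 1)` has order dividing `4`. -/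
lemma pow_four_eq_one_of_involution_of_idempotent {R : Type*} [Ring R] {t e : R}
    (ht : t * t = 1) (he : e * e = e) (hl : t * (e * t * e) = e * t * e)
    (hr : e * t * e * t = e * t * e) : (t * (e + e - 1)) ^ 4 = 1 := by
  -- The idempotents `e` and `q = t * e * t` commute with product `p`, so the square `(2q - 1)(2e -
  -- 1)` is a product of commuting involutions.
  set p := e * t * e with hp
  set q := t * e * t with hq
  have hqq : q * q = q := by
    rw [hq, show t * e * t * (t * e * t) = t * e * (t * t) * e * t by noncomm_ring, ht, mul_one,
      mul_assoc t e e, he]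
  have hqe : q * e = p := by
    rw [hq, ← hl, hp]
    noncomm_ring
  have heq : e * q = p := by
    rw [hq, ← hr, hp]
    noncomm_ring
  have hep : e * p = p := by rw [hp, ← mul_assoc, ← mul_assoc, he]
  have hpe : p * e = p := by rw [hp, mul_assoc, he]
  have hqp : q * p = p := by rw [hq, mul_assoc, hl, mul_assoc, hep, hl]
  have hpq : p * q = p := by rw [hq, ← mul_assoc, ← mul_assoc, hr, hpe, hr]
  have hpp : p * p = p := by
    nth_rewrite 1 [hp]
    rw [mul_assoc, hep, mul_assoc, hl, hep]
  have hsq : (t * (e + e - 1)) ^ 2 = p + p + p + p - q - q - e - e + 1 := by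
    have h₁ : t * e * (t * e) = p := by rw [← hqe, hq]; noncomm_ring
    have h₂ : t * (t * e) = e := by rw [← mul_assoc, ht, one_mul]
    rw [pow_two]
    simp only [mul_add, add_mul, mul_sub, sub_mul, mul_one, h₁, h₂, ht, ← hq]
    abel
  rw [show 4 = 2 * 2 from rfl, pow_mul, hsq, pow_two]
  simp only [mul_add, add_mul, mul_sub, sub_mul, mul_one, one_mul, hqq, hqe, heq, hep, hpe, hqp,
    hpq, hpp, he]
  abel

lemma groverWalkF_self_pow_four [NeZero L] (hL : Odd L) : groverWalkF L L ^ 4 = 1 := by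
  apply Matrix.toLin'.injective
  rw [Matrix.toLin'_pow, toLin'_groverWalkF_self hL, Matrix.toLin'_one]
  exact pow_four_eq_one_of_involution_of_idempotent (flipShift_mul_self hL)
    (chiralityMean_mul_self hL) flipShift_mul_mean mean_mul_flipShift

lemma waveTrace_self_eq_zero [NeZero L] {ψ : AddChar (ZMod L) ℂ} (hψ : ψ ≠ 1) :
    waveTrace L ψ = 0 := by
  have h := sum_displacement (fun k => ψ k) 0
  simp only [zero_sub] at h
  rw [waveTrace, h, AddChar.sum_eq_zero_of_ne_one hψ, mul_zero]

lemma four_le_of_groverWalkF_self_pow_eq_one [NeZero L] (hL : Odd L) (hL3 : 3 ≤ L) {n : ℕ}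
    (hn : 1 ≤ n) (hU : groverWalkF L L ^ n = 1) : 4 ≤ n := by
  have hω := Complex.isPrimitiveRoot_exp L (by omega)
  set ψ := AddChar.zmodChar L hω.pow_eq_one
  have hψ : ψ 1 ≠ 1 := by
    have h := AddChar.zmodChar_apply' hω.pow_eq_one 1
    rw [Nat.cast_one, pow_one] at h
    rw [h]
    exact hω.ne_one (by omega)
  have ht : waveTrace L ψ = 0 := waveTrace_self_eq_zero (by rintro h; simp [h] at hψ)
  have hu := groverWalkF_mulVec_planeWave hL ψ
  have hv := groverWalkF_mulVec_shiftedPlaneWave hL ψ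
  rw [ht, zero_smul, zero_sub] at hv
  have hind {a b : ℂ} (h : a • shiftedPlaneWave L ψ = b • planeWave L ψ) :=
    eq_zero_of_smul_shiftedPlaneWave_eq hL hL3 hψ h
  have hfix : (groverWalkF L L ^ n) *ᵥ planeWave L ψ = planeWave L ψ := by rw [hU, one_mulVec]
  by_contra! hlt
  -- The exponents `1, 2, 3` would give `v = u`, `-u = u` and `-v = u`, against independence.
  interval_cases n
  · rw [pow_one, hu] at hfix
    exact one_ne_zero (hind (a := 1) (b := 1) (by simpa using hfix)).1
  · rw [pow_two, ← mulVec_mulVec, hu, hv] at hfix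
    have := (hind (a := 0) (b := 2) (by
      rw [zero_smul, two_smul]
      nth_rewrite 1 [← hfix]
      simp)).2
    norm_num at this
  · rw [pow_succ, pow_two, ← mulVec_mulVec, ← mulVec_mulVec, hu, hv, mulVec_neg, hu] at hfix
    exact one_ne_zero (hind (a := 1) (b := -1) (by simp [← hfix])).1

end EqualSize

end CycleWalk

/-- For a prime `L ≥ 3` and every `N ≥ 2`, the `L`-state F-type Grover walk on the cycle with
`N` vertices has period `4` if `N = L` and infinite period otherwise. -/
theorem theorem4p4 (L : ℕ) (hL : L.Prime) (hL3 : 3 ≤ L) (N : ℕ) [NeZero N] (hN : 2 ≤ N) :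
    CycleWalk.period (CycleWalk.groverWalkF L N) = if N = L then (4 : ℕ∞) else ⊤ := by
  have hodd : Odd L := hL.odd_of_ne_two (by omega)
  rw [CycleWalk.period]
  split_ifs with h
  · subst h
    refine IsLeast.csInf_eq ⟨⟨4, by norm_num, CycleWalk.groverWalkF_self_pow_four hodd, rfl⟩, ?_⟩
    rintro _ ⟨n, hn, hU, rfl⟩
    exact_mod_cast CycleWalk.four_le_of_groverWalkF_self_pow_eq_one hodd hL3 hn hU
  · rw [sInf_eq_top]
    rintro _ ⟨n, hn, hU, rfl⟩
    obtain ⟨ω, hω, hω1, hint⟩ := CycleWalk.exists_not_isIntegral_geom_sum hL hL3 hN h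
    exact absurd (CycleWalk.isIntegral_geom_sum_of_pow_eq_one hodd hL3 hω hω1 hn hU) hint
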